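/- Let $\mathcal H$ be a complex Hilbert space and $\mathcal L(\mathcal H)$ the algebra of bounded linear operators on $\mathcal H$. For an abelian group $G$ (written additively) and a set $S\subseteq G$ with $0\in S$ and $-S=S$, a function $\phi:S\to\mathcal L(\mathcal H)$ is called positive definite if for all $n$ and all $g_1,\dots,g_n\in G$ such that $-g_i+g_j\in S$ for all $i,j$, the operator matrix $\bigl(\phi(-g_i+g_j)\bigr)_{i,j=1}^n$ is positive semidefinite, i.e. $\sum_{i,j=1}^n\langle\phi(-g_i+g_j)\xi_j,\xi_i\rangle\ge 0$ for all $\xi_1,\dots,\xi_n\in\mathcal H$; for $S=G$ this is the usual notion of a positive definite function on $G$. Let $G_1$ be a totally ordered abelian group, let $a\in G_1$ with $a>0$, and let $G_2$ be an abelian group. Put $(-a,a)=\{x\in G_1: -a<x<a\}$. Then for every positive definite function $\phi:(-a,a)\times G_2\to\mathcal L(\mathcal H)$ there is a positive definite function $\Phi:G_1\times G_2\to\mathcal L(\mathcal H)$ with $\Phi(x)=\phi(x)$ for all $x\in(-a,a)\times G_2$. -/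

import Mathlib

open scoped ComplexOrder InnerProductSpace

/-- The operator matrix `T = (T i j)` with entries in `L(H)` is positive semidefinite: as an operator
on the Hilbert space direct sum of `n` copies of `H` it satisfies `0 ≤ ⟪ξ, T ξ⟫` for every
`ξ = (ξ 1, …, ξ n)`. The order is the one of `ℂ`, so the quadratic form is in particular real. -/
def OperatorMatrixPosSemidef {H : Type*} [NormedAddCommGroup H] [InnerProductSpace ℂ H] {n : ℕ}
    (T : Fin n → Fin n → H →L[ℂ] H) : Prop :=
  ∀ ξ : Fin n → H, 0 ≤ ∑ i, ∑ j, ⟪ξ i, T i j (ξ j)⟫_ℂ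

/-- A function `Φ : G → L(H)` on a group (written additively) is positive definite if for all
`g 1, …, g n` in `G` the operator matrix `(Φ (-g i + g j))` is positive semidefinite. -/
def IsPositiveDefiniteFun {G : Type*} [AddGroup G] {H : Type*} [NormedAddCommGroup H]
    [InnerProductSpace ℂ H] (Φ : G → H →L[ℂ] H) : Prop :=
  ∀ (n : ℕ) (g : Fin n → G), OperatorMatrixPosSemidef fun i j => Φ (-g i + g j)

/-- A function `φ : S → L(H)` on a subset `S` of a group (written additively) is (partially)
positive definite if for all `g 1, …, g n` in `G` such that every `-g i + g j` lies in `S`, the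
operator matrix `(φ (-g i + g j))` is positive semidefinite. -/
def IsPositiveDefiniteFunOn {G : Type*} [AddGroup G] {H : Type*} [NormedAddCommGroup H]
    [InnerProductSpace ℂ H] (S : Set G) (φ : S → H →L[ℂ] H) : Prop :=
  ∀ (n : ℕ) (g : Fin n → G) (hg : ∀ i j, -g i + g j ∈ S),
    OperatorMatrixPosSemidef fun i j => φ ⟨-g i + g j, hg i j⟩

/-! On `G × H` put the partial real kernel `k (x, ξ) (y, η) = Re ⟪ξ, φ (-x + y) η⟫`, known on the
edges of the graph `|π y - π x| < a`. Three facts give the extension. Chordality: the lower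
neighbours of a vertex lie in an interval shorter than `a`, so they form a clique. Gaussian
elimination from the top creates no new edges. A positive matrix supported on edges is thus a sum of
positive rank-one matrices supported on cliques, and `k` pairs nonnegatively with it
(`sum_mul_nonneg_of_posSemidef_of_clique`). Duality with averaging: M. Riesz extends this functional
to all finite matrices. The kernel is invariant under translations and unit scalars, which commute,
so Markov–Kakutani averages make the extension invariant (`riesz_extension_invariant`). Recovery of
operators: the diagonal blocks are still `φ 0`, so Cauchy–Schwarz forces linearity and boundedness
in `ξ`, and invariance under `I` gives sesquilinearity. -/

/-! ### Invariant extension of positive functionals -/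

/-- If `L` is nonnegative on `D ∩ s` and invariant on `D` under the commuting operators `T i`, which
preserve `D` and the cone `s`, then `L` is nonnegative at the elements of `D` that can be moved into
`s` by adding a finite sum of coboundaries `y - T i y`. -/
theorem nonneg_of_add_coboundaries_mem {E ι : Type*} [AddCommGroup E] [Module ℝ E]
    (s : PointedCone ℝ E) (D : Submodule ℝ E) (L : E →ₗ[ℝ] ℝ) (T : ι → Module.End ℝ E)
    (hcomm : ∀ i j, Commute (T i) (T j)) (hs : ∀ i, ∀ x ∈ s, T i x ∈ s)
    (hD : ∀ i, ∀ x ∈ D, T i x ∈ D) (hL : ∀ i, ∀ x ∈ D, L (T i x) = L x)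
    (hpos : ∀ x ∈ D, x ∈ s → 0 ≤ L x) (hdom : ∀ y, ∃ x ∈ D, x + y ∈ s)
    (t : Finset ι) (y : ι → E) (x : E) (hx : x ∈ D)
    (h : x + ∑ i ∈ t, (y i - T i (y i)) ∈ s) : 0 ≤ L x := by
  classical
  induction t using Finset.induction_on generalizing y x with
  | empty => exact hpos x hx (by simpa using h)
  | insert i t hi ih =>
    obtain ⟨d, hdD, hd⟩ := hdom (y i)
    obtain ⟨e, heD, he⟩ := hdom (-y i)
    have hpow : ∀ n : ℕ, (∀ z ∈ s, (T i ^ n) z ∈ s) ∧ (∀ z ∈ D, (T i ^ n) z ∈ D) ∧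
        ∀ z ∈ D, L ((T i ^ n) z) = L z := by
      intro n
      induction n with
      | zero => simp
      | succ n ihn =>
        simp only [pow_succ', Module.End.mul_apply]
        exact ⟨fun z hz => hs i _ (ihn.1 z hz), fun z hz => hD i _ (ihn.2.1 z hz),
          fun z hz => (hL i _ (ihn.2.1 z hz)).trans (ihn.2.2 z hz)⟩
    have key : ∀ n : ℕ, 0 < n → 0 ≤ L x + (n : ℝ)⁻¹ * (L e + L d) := by
      intro n hn
      have hn0 : (0 : ℝ) < n := by exact_mod_cast hn
      -- Averaging over `T i` telescopes the `i`-th coboundary to size `1 / n`. Domination by `d`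
      -- and `e` absorbs the remainder, at a cost in `L` that vanishes as `n` grows.
      set A : Module.End ℝ E := (n : ℝ)⁻¹ • ∑ m ∈ Finset.range n, T i ^ m with hA
      have hAx : ∀ z, A z = (n : ℝ)⁻¹ • ∑ m ∈ Finset.range n, (T i ^ m) z := by
        intro z; simp [hA, LinearMap.sum_apply]
      have hAs : ∀ z ∈ s, A z ∈ s := fun z hz => by
        rw [hAx]
        exact s.smul_mem (inv_nonneg.2 hn0.le) (Submodule.sum_mem _ fun m _ => (hpow m).1 z hz)
      have hAD : ∀ z ∈ D, A z ∈ D := fun z hz => by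
        rw [hAx]
        exact D.smul_mem _ (Submodule.sum_mem _ fun m _ => (hpow m).2.1 z hz)
      have hAL : ∀ z ∈ D, L (A z) = L z := fun z hz => by
        rw [hAx, map_smul, map_sum, Finset.sum_congr rfl fun m _ => (hpow m).2.2 z hz]
        simp [hn0.ne']
      have hAcomm : ∀ j, ∀ z, A (T j z) = T j (A z) := fun j z => by
        have : Commute A (T j) :=
          (Commute.sum_left _ _ _ fun m _ => (hcomm i j).pow_left m).smul_left _
        exact LinearMap.congr_fun this.eq z
      have hAcob : A (y i - T i (y i)) = (n : ℝ)⁻¹ • (y i - (T i ^ n) (y i)) := by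
        have := LinearMap.congr_fun (geom_sum_mul_neg (T i) n) (y i)
        simp only [Module.End.mul_apply, LinearMap.sub_apply, Module.End.one_apply,
          LinearMap.sum_apply] at this
        rw [hAx, this]
      have h1 := hAs _ h
      rw [Finset.sum_insert hi, map_add, map_add, hAcob, map_sum] at h1
      have h2 : (n : ℝ)⁻¹ • ((e + -y i) + (T i ^ n) (d + y i)) ∈ s :=
        s.smul_mem (inv_nonneg.2 hn0.le) (s.add_mem he ((hpow n).1 _ hd))
      have h3 := s.add_mem h1 h2
      have h4 := ih (fun j => A (y j)) (A x + (n : ℝ)⁻¹ • (e + (T i ^ n) d))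
        (D.add_mem (hAD x hx) (D.smul_mem _ (D.add_mem heD ((hpow n).2.1 d hdD)))) (by
          convert h3 using 1
          simp only [map_sub, map_add, hAcomm, smul_add, smul_sub, smul_neg]
          abel)
      rwa [map_add, map_smul, map_add, hAL x hx, (hpow n).2.2 d hdD, smul_eq_mul] at h4
    by_contra! hneg
    obtain ⟨n, hn⟩ := exists_nat_gt ((L e + L d) / -L x)
    have hn1 := key (n + 1) n.succ_pos
    rw [div_lt_iff₀ (by linarith)] at hn
    have hn2 : (0 : ℝ) < (n + 1 : ℕ) := by positivity
    have := mul_nonneg hn2.le hn1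
    rw [mul_add, mul_inv_cancel_left₀ hn2.ne'] at this
    push_cast at this
    nlinarith

/-- **M. Riesz extension theorem**, equivariant form: a functional that is nonnegative on `D ∩ s`
and invariant under commuting operators `T i` preserving `D` and the cone `s` has an extension that
is nonnegative on `s` and invariant. -/
theorem riesz_extension_invariant {E ι : Type*} [AddCommGroup E] [Module ℝ E]
    (s : PointedCone ℝ E) (D : Submodule ℝ E) (L : E →ₗ[ℝ] ℝ) (T : ι → Module.End ℝ E)
    (hcomm : ∀ i j, Commute (T i) (T j)) (hs : ∀ i, ∀ x ∈ s, T i x ∈ s)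
    (hD : ∀ i, ∀ x ∈ D, T i x ∈ D) (hL : ∀ i, ∀ x ∈ D, L (T i x) = L x)
    (hpos : ∀ x ∈ D, x ∈ s → 0 ≤ L x) (hdom : ∀ y, ∃ x ∈ D, x + y ∈ s) :
    ∃ f : E →ₗ[ℝ] ℝ, (∀ x ∈ D, f x = L x) ∧ (∀ x ∈ s, 0 ≤ f x) ∧ ∀ i x, f (T i x) = f x := by
  classical
  -- An extension is invariant exactly when it kills the coboundaries, so `L` is first extended by
  -- zero to `D + N`.
  let N : Submodule ℝ E := LinearMap.range (Finsupp.lsum ℝ fun i : ι => (1 - T i : E →ₗ[ℝ] E))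
  have hN : ∀ x ∈ D, ∀ y ∈ N, x + y ∈ s → 0 ≤ L x := by
    rintro x hx _ ⟨y, rfl⟩ h
    refine nonneg_of_add_coboundaries_mem s D L T hcomm hs hD hL hpos hdom y.support y x hx ?_
    simpa [Finsupp.sum] using h
  have hcob : ∀ i x, x - T i x ∈ N := fun i x => ⟨Finsupp.single i x, by simp⟩
  have hDN : ∀ x ∈ D, x ∈ N → L x = 0 := by
    intro x hx hxN
    refine le_antisymm ?_ (hN x hx (-x) (N.neg_mem hxN) (by simp))
    simpa using hN (-x) (D.neg_mem hx) x hxN (by simp)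
  let F : E →ₗ.[ℝ] ℝ := ⟨D, L.domRestrict D⟩
  let Z : E →ₗ.[ℝ] ℝ := ⟨N, 0⟩
  have hFZ : ∀ (x : F.domain) (y : Z.domain), (x : E) = y → F x = Z y := by
    rintro ⟨x, hx⟩ ⟨y, hy⟩ (rfl : x = y)
    exact hDN x hx hy
  have hval : ∀ (x : E) (hx : x ∈ D) (y : E) (hy : y ∈ N) (z : (F.sup Z hFZ).domain),
      x + y = z → F.sup Z hFZ z = L x := by
    intro x hx y hy z hz
    rw [LinearPMap.sup_apply hFZ ⟨x, hx⟩ ⟨y, hy⟩ z hz]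
    exact add_zero _
  obtain ⟨f, hf, hfs⟩ := riesz_extension s (F.sup Z hFZ)
    (by
      rintro ⟨z, hz⟩ hzs
      obtain ⟨x, hx, y, hy, rfl⟩ := Submodule.mem_sup.1 hz
      rw [hval x hx y hy _ rfl]
      exact hN x hx y hy hzs)
    (fun y => by
      obtain ⟨x, hx, h⟩ := hdom y
      exact ⟨⟨x, Submodule.mem_sup_left hx⟩, h⟩)
  refine ⟨f, fun x hx => ?_, hfs, fun i x => ?_⟩
  · rw [← hval x hx 0 N.zero_mem ⟨x, Submodule.mem_sup_left hx⟩ (add_zero x)]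
    exact hf ⟨x, Submodule.mem_sup_left hx⟩
  · have h := hf ⟨x - T i x, Submodule.mem_sup_right (hcob i x)⟩
    rw [hval 0 D.zero_mem _ (hcob i x) _ (zero_add _), map_zero, map_sub] at h
    linarith

/-! ### Elimination on interval graphs -/

/-- Sparse Cholesky decomposition, in dual form. Let `p` map a finite set `V` to an ordered abelian
group, and call `u`, `v` adjacent if `-a < p v - p u < a`. If a real symmetric kernel `k` is positive
semidefinite on cliques, then it pairs nonnegatively with every positive semidefinite matrix that
vanishes off the adjacent pairs of `V`. -/
theorem sum_mul_nonneg_of_posSemidef_of_clique {X G : Type*} [AddCommGroup G] [LinearOrder G]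
    [IsOrderedAddMonoid G] (p : X → G) (a : G) (k : X → X → ℝ)
    (hk : ∀ (W : Finset X) (c : X → ℝ), (∀ u ∈ W, ∀ v ∈ W, p v - p u < a) →
      0 ≤ ∑ u ∈ W, ∑ v ∈ W, c u * c v * k u v)
    (V : Finset X) (A : X → X → ℝ) (hsymm : ∀ u v, A u v = A v u)
    (hA : ∀ u ∈ V, ∀ v ∈ V, A u v ≠ 0 → p v - p u < a)
    (hpos : ∀ c : X → ℝ, 0 ≤ ∑ u ∈ V, ∑ v ∈ V, A u v * (c u * c v)) :
    0 ≤ ∑ u ∈ V, ∑ v ∈ V, A u v * k u v := by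
  classical
  induction V using Finset.induction_on_max_value p generalizing A with
  | empty => simp
  | insert n V hn hmax ih =>
    have expand : ∀ f : X → X → ℝ, ∑ u ∈ insert n V, ∑ v ∈ insert n V, f u v =
        f n n + ∑ v ∈ V, f n v + ∑ u ∈ V, f u n + ∑ u ∈ V, ∑ v ∈ V, f u v := by
      intro f
      simp only [Finset.sum_insert hn, Finset.sum_add_distrib]
      ring
    have hform : ∀ (c : X → ℝ) (r : ℝ), 0 ≤ A n n * r ^ 2 + 2 * r * ∑ v ∈ V, A n v * c v +
        ∑ u ∈ V, ∑ v ∈ V, A u v * (c u * c v) := by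
      intro c r
      have hne : ∀ u ∈ V, Function.update c n r u = c u := fun u hu =>
        Function.update_of_ne (ne_of_mem_of_not_mem hu hn) _ _
      have e0 : ∑ u ∈ V, ∑ v ∈ V, A u v * (Function.update c n r u * Function.update c n r v) =
          ∑ u ∈ V, ∑ v ∈ V, A u v * (c u * c v) :=
        Finset.sum_congr rfl fun u hu => Finset.sum_congr rfl fun v hv => by rw [hne u hu, hne v hv]
      have e1 : ∑ v ∈ V, A n v * (r * Function.update c n r v) = r * ∑ v ∈ V, A n v * c v := by
        rw [Finset.mul_sum]
        exact Finset.sum_congr rfl fun v hv => by rw [hne v hv]; ring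
      have e2 : ∑ u ∈ V, A u n * (Function.update c n r u * r) = r * ∑ v ∈ V, A n v * c v := by
        rw [Finset.mul_sum]
        exact Finset.sum_congr rfl fun u hu => by rw [hne u hu, hsymm u n]; ring
      refine (hpos (Function.update c n r)).trans_eq ?_
      rw [expand, Function.update_self, e0, e1, e2]
      ring
    have hnn : 0 ≤ A n n := by simpa using hform 0 1
    -- A zero pivot forces its whole row to vanish; a positive one allows a Schur complement.
    rcases hnn.eq_or_lt with h0 | hnn
    · have hz : ∀ v ∈ V, A n v = 0 := by
        intro w hw
        by_contra hne
        have hq : ∀ r : ℝ, 0 ≤ 2 * r * A n w + A w w := by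
          intro r
          have h := hform (Pi.single w 1) r
          rw [← h0] at h
          simpa [Pi.single_apply, hw] using h
        have e : 2 * ((-A w w - 1) / (2 * A n w) * A n w) = -A w w - 1 := by field_simp
        have := hq ((-A w w - 1) / (2 * A n w))
        rw [mul_assoc, e] at this
        linarith
      rw [expand, ← h0, Finset.sum_eq_zero fun v hv => by rw [hz v hv, zero_mul],
        Finset.sum_eq_zero fun u hu => by rw [hsymm u n, hz u hu, zero_mul]]
      simpa using ih A hsymm (fun u hu v hv => hA u (by simp [hu]) v (by simp [hv])) fun c => by simpa using hform c 0
    · have hnn' := hnn.ne'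
      have hB := ih (fun u v => A u v - A n u * A n v / A n n)
        (fun u v => by rw [hsymm u v, mul_comm (A n u)])
        ?_ ?_
      -- The subtracted rank-one part lives on `n` and its neighbours, a clique because `p n` is
      -- maximal.
      · have hW := hk ((insert n V).filter fun u => A n u ≠ 0) (A n) ?_
        · have e1 : ∑ u ∈ (insert n V).filter (fun u => A n u ≠ 0),
              ∑ v ∈ (insert n V).filter (fun u => A n u ≠ 0), A n u * A n v * k u v =
              ∑ u ∈ insert n V, ∑ v ∈ insert n V, A n u * A n v * k u v := by
            rw [Finset.sum_filter]
            refine Finset.sum_congr rfl fun u _ => ?_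
            split_ifs with hu
            · rw [Finset.sum_filter]
              refine Finset.sum_congr rfl fun v _ => ?_
              split_ifs with hv
              · rfl
              · rw [not_not.1 hv]; ring
            · rw [not_not.1 hu]; simp
          rw [e1] at hW
          have hW' := div_nonneg hW hnn.le
          refine (add_nonneg hB hW').trans_eq ?_
          rw [expand, expand, add_div, add_div, add_div, Finset.sum_div, Finset.sum_div,
            Finset.sum_div]
          simp only [Finset.sum_div, sub_mul, Finset.sum_sub_distrib]
          have e2 : ∑ u ∈ V, ∑ v ∈ V, A n u * A n v / A n n * k u v =
              ∑ u ∈ V, ∑ v ∈ V, A n u * A n v * k u v / A n n :=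
            Finset.sum_congr rfl fun _ _ => Finset.sum_congr rfl fun _ _ => by ring
          have e3 : ∑ v ∈ V, A n n * A n v * k n v / A n n = ∑ v ∈ V, A n v * k n v :=
            Finset.sum_congr rfl fun _ _ => by field_simp
          have e4 : ∑ u ∈ V, A n u * A n n * k u n / A n n = ∑ u ∈ V, A u n * k u n :=
            Finset.sum_congr rfl fun u _ => by rw [hsymm u n]; field_simp
          have e5 : A n n * A n n * k n n / A n n = A n n * k n n := by field_simp
          rw [e2, e3, e4, e5]
          ring
        · intro u hu v hv
          simp only [Finset.mem_filter, Finset.mem_insert] at hu hv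
          have hvn : p v ≤ p n := by
            rcases hv.1 with rfl | h
            exacts [le_rfl, hmax v h]
          exact (sub_le_sub_right hvn _).trans_lt (hA u (by simpa using hu.1) n (by simp)
            (by rw [hsymm]; exact hu.2))
      · intro u hu v hv h
        by_cases hz : A n u * A n v = 0
        · exact hA u (by simp [hu]) v (by simp [hv]) fun h0 => h (by simp [hz, h0])
        · exact (sub_le_sub_right (hmax v hv) _).trans_lt (hA u (by simp [hu]) n (by simp)
            (by rw [hsymm]; exact left_ne_zero_of_mul hz))
      · intro c
        -- This `r` minimises the quadratic in `hform`, and the minimum is the form of the Schur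
        -- complement.
        have h := hform c (-(∑ v ∈ V, A n v * c v) / A n n)
        refine h.trans_eq ?_
        simp only [sub_mul, Finset.sum_sub_distrib]
        have e : ∑ u ∈ V, ∑ v ∈ V, A n u * A n v / A n n * (c u * c v) =
            (∑ v ∈ V, A n v * c v) * (∑ v ∈ V, A n v * c v) / A n n := by
          rw [Finset.sum_mul_sum, Finset.sum_div]
          refine Finset.sum_congr rfl fun _ _ => ?_
          rw [Finset.sum_div]
          exact Finset.sum_congr rfl fun _ _ => by ring
        rw [e]
        field_simp
        ring

/-! ### Extension of invariant kernels -/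

/-- The cone of finitely supported real matrices with nonnegative quadratic form. -/
def Finsupp.nonnegFormCone (X : Type*) : PointedCone ℝ (X × X →₀ ℝ) where
  carrier := {A | ∀ c : X → ℝ, 0 ≤ Finsupp.linearCombination ℝ (fun q => c q.1 * c q.2) A}
  add_mem' hA hB c := by
    rw [map_add]
    exact add_nonneg (hA c) (hB c)
  zero_mem' c := by simp
  smul_mem' r A hA c := by
    have h := mul_nonneg r.2 (hA c)
    rw [← smul_eq_mul, ← map_smul] at h
    exact h

theorem Finsupp.mem_nonnegFormCone {X : Type*} {A : X × X →₀ ℝ} :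
    A ∈ Finsupp.nonnegFormCone X ↔
      ∀ c : X → ℝ, 0 ≤ Finsupp.linearCombination ℝ (fun q => c q.1 * c q.2) A :=
  Iff.rfl

/-- A partial kernel that is positive semidefinite on the cliques of the graph `|p v - p u| < a` is
nonnegative on the finitely supported matrices with nonnegative quadratic form that are supported on
the edges of the graph. -/
theorem linearCombination_nonneg_of_clique {X G : Type*} [AddCommGroup G] [LinearOrder G]
    [IsOrderedAddMonoid G] (p : X → G) (a : G) (k : X → X → ℝ)
    (hsymm : ∀ u v, k u v = k v u)
    (hk : ∀ (W : Finset X) (c : X → ℝ), (∀ u ∈ W, ∀ v ∈ W, p v - p u < a) →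
      0 ≤ ∑ u ∈ W, ∑ v ∈ W, c u * c v * k u v)
    (A : X × X →₀ ℝ) (hA : A ∈ Finsupp.nonnegFormCone X)
    (hsupp : A ∈ Finsupp.supported ℝ ℝ {q : X × X | p q.2 - p q.1 < a ∧ p q.1 - p q.2 < a}) :
    0 ≤ Finsupp.linearCombination ℝ (fun q => k q.1 q.2) A := by
  classical
  set V : Finset X := A.support.image Prod.fst ∪ A.support.image Prod.snd with hV
  have hsum : ∀ g : X → X → ℝ, (∀ u v, g u v = g v u) →
      Finsupp.linearCombination ℝ (fun q : X × X => g q.1 q.2) A =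
        ∑ u ∈ V, ∑ v ∈ V, (A (u, v) + A (v, u)) / 2 * g u v := by
    intro g hg
    have h1 : Finsupp.linearCombination ℝ (fun q : X × X => g q.1 q.2) A =
        ∑ u ∈ V, ∑ v ∈ V, A (u, v) * g u v := by
      rw [Finsupp.linearCombination_apply, Finsupp.sum_of_support_subset A (s := V ×ˢ V) _ _
        (by simp), Finset.sum_product]
      · rfl
      · intro q hq
        rw [Finset.mem_product, hV]
        exact ⟨Finset.mem_union_left _ (Finset.mem_image_of_mem _ hq),
          Finset.mem_union_right _ (Finset.mem_image_of_mem _ hq)⟩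
    have h2 : ∑ u ∈ V, ∑ v ∈ V, A (u, v) * g u v = ∑ u ∈ V, ∑ v ∈ V, A (v, u) * g u v := by
      rw [Finset.sum_comm]
      exact Finset.sum_congr rfl fun u _ => Finset.sum_congr rfl fun v _ => by rw [hg]
    have h3 : ∑ u ∈ V, ∑ v ∈ V, (A (u, v) + A (v, u)) / 2 * g u v =
        (∑ u ∈ V, ∑ v ∈ V, A (u, v) * g u v + ∑ u ∈ V, ∑ v ∈ V, A (v, u) * g u v) / 2 := by
      simp only [← Finset.sum_add_distrib, Finset.sum_div]
      exact Finset.sum_congr rfl fun u _ => Finset.sum_congr rfl fun v _ => by ring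
    rw [h1, h3, ← h2]
    ring
  rw [hsum _ hsymm]
  refine sum_mul_nonneg_of_posSemidef_of_clique p a k hk V (fun u v => (A (u, v) + A (v, u)) / 2)
    (fun u v => by rw [add_comm]) (fun u _ v _ h => ?_) fun c => ?_
  · by_cases h0 : A (u, v) = 0
    · have h1 : A (v, u) ≠ 0 := fun h1 => h (by simp [h0, h1])
      exact ((Finsupp.mem_supported ℝ A).1 hsupp (Finsupp.mem_support_iff.2 h1)).2
    · exact ((Finsupp.mem_supported ℝ A).1 hsupp (Finsupp.mem_support_iff.2 h0)).1
  · rw [← hsum (fun u v => c u * c v) fun u v => mul_comm _ _]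
    exact hA c

/-- A real symmetric partial kernel that is positive semidefinite on the cliques of the graph
`|p v - p u| < a` and invariant under a commuting family of graph morphisms extends to an invariant
positive semidefinite kernel, given here as a form on finitely supported functions. -/
theorem exists_invariant_posSemidef_extension {X G ι : Type*} [AddCommGroup G] [LinearOrder G]
    [IsOrderedAddMonoid G] (p : X → G) (a : G) (ha : 0 < a) (k : X → X → ℝ)
    (hsymm : ∀ u v, k u v = k v u)
    (hk : ∀ (W : Finset X) (c : X → ℝ), (∀ u ∈ W, ∀ v ∈ W, p v - p u < a) →
      0 ≤ ∑ u ∈ W, ∑ v ∈ W, c u * c v * k u v)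
    (τ : ι → X → X) (hτ : ∀ i j x, τ i (τ j x) = τ j (τ i x))
    (hp : ∀ i u v, p (τ i v) - p (τ i u) = p v - p u)
    (hkτ : ∀ i u v, p v - p u < a → p u - p v < a → k (τ i u) (τ i v) = k u v) :
    ∃ B : LinearMap.BilinForm ℝ (X →₀ ℝ), LinearMap.IsSymm B ∧ (∀ w, 0 ≤ B w w) ∧
      (∀ i u v, B (.single (τ i u) 1) (.single (τ i v) 1) = B (.single u 1) (.single v 1)) ∧
      ∀ u v, p v - p u < a → p u - p v < a → B (.single u 1) (.single v 1) = k u v := by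
  classical
  obtain ⟨f, hfD, hfs, hfT⟩ := riesz_extension_invariant (Finsupp.nonnegFormCone X)
    (Finsupp.supported ℝ ℝ {q : X × X | p q.2 - p q.1 < a ∧ p q.1 - p q.2 < a})
    (Finsupp.linearCombination ℝ fun q => k q.1 q.2)
    (fun i => Finsupp.lmapDomain ℝ ℝ (Prod.map (τ i) (τ i)))
    (fun i j => by
      rw [commute_iff_eq, Module.End.mul_eq_comp, Module.End.mul_eq_comp,
        ← Finsupp.lmapDomain_comp, ← Finsupp.lmapDomain_comp]
      congr 1
      ext q
      · exact hτ i j q.1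
      · exact hτ i j q.2)
    (fun i A hA c => by
      rw [Finsupp.lmapDomain_apply, Finsupp.linearCombination_mapDomain]
      exact hA fun x => c (τ i x))
    (fun i A hA => by
      rw [Finsupp.mem_supported] at hA ⊢
      intro q hq
      obtain ⟨r, hr, rfl⟩ := Finset.mem_image.1 (Finsupp.mapDomain_support hq)
      simpa [hp] using hA hr)
    (fun i A hA => by
      rw [Finsupp.lmapDomain_apply, Finsupp.linearCombination_mapDomain,
        Finsupp.linearCombination_apply, Finsupp.linearCombination_apply]
      refine Finsupp.sum_congr fun q hq => ?_
      have h := (Finsupp.mem_supported ℝ A).1 hA hq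
      exact congrArg (A q • ·) (hkτ i q.1 q.2 h.1 h.2))
    (fun A hA hAs => linearCombination_nonneg_of_clique p a k hsymm hk A hAs hA)
    (fun A => by
      induction A using Finsupp.induction_linear with
      | zero => exact ⟨0, Submodule.zero_mem _, by simp⟩
      | add A B hA hB =>
        obtain ⟨x, hx, h⟩ := hA
        obtain ⟨y, hy, h'⟩ := hB
        exact ⟨x + y, Submodule.add_mem _ hx hy, by
          simpa only [add_add_add_comm] using Submodule.add_mem _ h h'⟩
      | single q r =>
        -- The diagonal lies in the domain since `0 < a`, and `|r| (s² + t²) + r s t ≥ 0` dominates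
        -- any entry.
        refine ⟨.single (q.1, q.1) |r| + .single (q.2, q.2) |r|,
          Submodule.add_mem _ (Finsupp.single_mem_supported _ _ (by simpa using ha))
            (Finsupp.single_mem_supported _ _ (by simpa using ha)), fun c => ?_⟩
        simp only [map_add, Finsupp.linearCombination_single, smul_eq_mul]
        nlinarith [abs_nonneg r, neg_abs_le r, le_abs_self r, sq_nonneg (c q.1 + c q.2),
          sq_nonneg (c q.1 - c q.2),
          mul_nonneg (sub_nonneg.2 (le_abs_self r)) (sq_nonneg (c q.1 - c q.2)),
          mul_nonneg (neg_le_iff_add_nonneg.1 (neg_abs_le r)) (sq_nonneg (c q.1 + c q.2))])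
  have hB : ∀ u v, Finsupp.linearCombination ℝ (fun u => Finsupp.linearCombination ℝ
      fun v => f (.single (u, v) 1)) (.single u 1) (.single v 1) = f (.single (u, v) 1) := by
    simp
  refine ⟨Finsupp.linearCombination ℝ fun u => Finsupp.linearCombination ℝ
    fun v => f (.single (u, v) 1), ?_, fun w => ?_, fun i u v => ?_, fun u v h1 h2 => ?_⟩
  -- Matrices in the cone need not be symmetric: antisymmetric ones have zero form, so `f` vanishes
  -- on them.
  · have hsw : ∀ u v, f (.single (u, v) 1) ≤ f (.single (v, u) 1) := by
      intro u v
      rw [← sub_nonneg, ← map_sub]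
      refine hfs _ fun c => ?_
      simp [mul_comm]
    rw [LinearMap.isSymm_iff_basis Finsupp.basisSingleOne]
    intro u v
    rw [Finsupp.coe_basisSingleOne]
    exact (hB u v).trans ((le_antisymm (hsw u v) (hsw v u)).trans (hB v u).symm)
  · have h := hfs (∑ u ∈ w.support, ∑ v ∈ w.support, (w u * w v) • .single (u, v) 1) fun c => by
      simp only [map_sum, map_smul, Finsupp.linearCombination_single, smul_eq_mul, one_mul]
      refine (mul_self_nonneg (∑ u ∈ w.support, w u * c u)).trans_eq ?_
      rw [Finset.sum_mul_sum]
      exact Finset.sum_congr rfl fun _ _ => Finset.sum_congr rfl fun _ _ => by ring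
    refine h.trans_eq ?_
    simp only [Finsupp.linearCombination_apply, Finsupp.sum, LinearMap.sum_apply, map_sum, map_smul,
      LinearMap.smul_apply, smul_eq_mul, Finset.mul_sum, mul_assoc]
  · rw [hB, hB, ← hfT i (.single (u, v) 1), Finsupp.lmapDomain_apply, Finsupp.mapDomain_single]
    rfl
  · rw [hB, hfD _ (Finsupp.single_mem_supported _ _ ⟨h1, h2⟩)]
    simp

/-! ### From kernels to operators -/

/-- A bounded real bilinear form on a complex Hilbert space that is invariant under multiplication of
both arguments by `I` is the real part of a bounded complex sesquilinear form. -/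
theorem exists_continuousLinearMap_re_inner_eq {H : Type*} [NormedAddCommGroup H]
    [InnerProductSpace ℂ H] [CompleteSpace H] (b : H → H → ℝ)
    (hadd_left : ∀ x y z, b (x + y) z = b x z + b y z)
    (hadd_right : ∀ x y z, b x (y + z) = b x y + b x z)
    (hsmul_left : ∀ (r : ℝ) x y, b (r • x) y = r * b x y)
    (hsmul_right : ∀ (r : ℝ) x y, b x (r • y) = r * b x y)
    (hI : ∀ x y, b (Complex.I • x) (Complex.I • y) = b x y)
    (C : ℝ) (hC : ∀ x y, |b x y| ≤ C * ‖x‖ * ‖y‖) :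
    ∃ T : H →L[ℂ] H, ∀ x y, (⟪x, T y⟫_ℂ).re = b x y := by
  have hneg_left : ∀ x y, b (-x) y = -b x y := fun x y => by simpa using hsmul_left (-1) x y
  have hneg_right : ∀ x y, b x (-y) = -b x y := fun x y => by simpa using hsmul_right (-1) x y
  have hII : ∀ x : H, Complex.I • Complex.I • x = -x := fun x => by
    rw [smul_smul, Complex.I_mul_I, neg_one_smul]
  have hIr : ∀ x y, b x (Complex.I • y) = -b (Complex.I • x) y := fun x y => by
    rw [← hI x, hII, hneg_right]
  have hsplit : ∀ (z : ℂ) (x : H), z • x = z.re • x + z.im • Complex.I • x :=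
    fun z x => by
      rw [← Complex.coe_smul, ← Complex.coe_smul, smul_smul, ← add_smul, Complex.re_add_im]
  -- The imaginary part is forced: `Im ⟪x, z⟫ = Re ⟪I • x, z⟫`.
  let F : H →ₗ⋆[ℂ] H →ₗ[ℂ] ℂ := LinearMap.mk₂'ₛₗ (starRingEnd ℂ) (RingHom.id ℂ)
    (fun x y => (⟨b x y, b (Complex.I • x) y⟩ : ℂ))
    (fun x y z => by apply Complex.ext <;> simp [hadd_left])
    (fun c x y => by
      rw [hsplit c x]
      apply Complex.ext <;>
        simp [hadd_left, hsmul_left, hneg_left, hII, smul_comm Complex.I (_ : ℝ), sub_eq_add_neg])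
    (fun x y z => by apply Complex.ext <;> simp [hadd_right])
    (fun c x y => by
      rw [hsplit c y]
      apply Complex.ext <;> simp [hadd_right, hsmul_right, hIr, sub_eq_add_neg, hII, hneg_left])
  have hF : ∀ x y, ‖F x y‖ ≤ (2 * C) * ‖x‖ * ‖y‖ := fun x y => by
    refine (Complex.norm_le_abs_re_add_abs_im _).trans ?_
    have h1 := hC x y
    have h2 := hC (Complex.I • x) y
    rw [norm_smul, Complex.norm_I, one_mul] at h2
    change |b x y| + |b (Complex.I • x) y| ≤ _
    linarith
  refine ⟨(InnerProductSpace.continuousLinearMapOfBilin (F.mkContinuous₂ _ hF)).adjoint,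
    fun x y => ?_⟩
  rw [ContinuousLinearMap.adjoint_inner_right, InnerProductSpace.continuousLinearMapOfBilin_apply]
  rfl

/-- A positive definite function on a symmetric set, extended by zero to the whole group, is
hermitian. -/
theorem re_inner_symm_of_posSemidef {G : Type*} [AddCommGroup G] {H : Type*}
    [NormedAddCommGroup H] [InnerProductSpace ℂ H] (S : Set G) (h0 : (0 : G) ∈ S)
    (hS : ∀ g ∈ S, -g ∈ S) (ψ : G → H →L[ℂ] H)
    (hψ : ∀ (n : ℕ) (g : Fin n → G), (∀ i j, -g i + g j ∈ S) →
      OperatorMatrixPosSemidef fun i j => ψ (-g i + g j))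
    (hψ0 : ∀ g ∉ S, ψ g = 0) (g : G) (ξ η : H) :
    (⟪ξ, ψ g η⟫_ℂ).re = (⟪η, ψ (-g) ξ⟫_ℂ).re := by
  by_cases hg : g ∈ S
  · have hdiag : ∀ ζ : H, (⟪ζ, ψ 0 ζ⟫_ℂ).im = 0 := fun ζ => by
      have h := hψ 1 (fun _ => 0) (by simpa using h0) fun _ => ζ
      exact ((Complex.nonneg_iff.1 (by simpa using h)).2).symm
    -- Polarisation: the factor `I` turns reality of the quadratic form into equality of the real
    -- parts.
    have h := hψ 2 ![0, g] (by simp [Fin.forall_fin_two, h0, hg, hS g hg]) ![ξ, Complex.I • η]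
    have him := (Complex.nonneg_iff.1 h).2
    simp [Fin.sum_univ_two, hdiag] at him
    linarith
  · rw [hψ0 g hg, hψ0 (-g) fun h => hg (by simpa using hS _ h)]
    simp

/-- A positive definite function on the preimage of the interval `(-a, a)` under a homomorphism from
an abelian group to a totally ordered abelian group extends to a positive definite function. -/
theorem exists_isPositiveDefiniteFun_extension {G G₁ : Type*} [AddCommGroup G] [AddCommGroup G₁]
    [LinearOrder G₁] [IsOrderedAddMonoid G₁] {H : Type*} [NormedAddCommGroup H]
    [InnerProductSpace ℂ H] [CompleteSpace H] (π : G →+ G₁) (a : G₁) (ha : 0 < a) (S : Set G)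
    (hSmem : ∀ g, g ∈ S ↔ π g ∈ Set.Ioo (-a) a) (φ : S → H →L[ℂ] H)
    (hφ : IsPositiveDefiniteFunOn S φ) :
    ∃ Φ : G → H →L[ℂ] H, IsPositiveDefiniteFun Φ ∧ ∀ x : S, Φ x = φ x := by
  classical
  have hmem : ∀ x y : G, -x + y ∈ S ↔ π y - π x < a ∧ π x - π y < a := by
    intro x y
    rw [hSmem, map_add, map_neg, Set.mem_Ioo, neg_add_eq_sub, and_comm, neg_lt, neg_sub]
  have h0 : (0 : G) ∈ S := by simpa [hSmem] using ha
  have hS : ∀ g ∈ S, -g ∈ S := by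
    intro g hg
    have h := (hmem 0 g).1 (by simpa using hg)
    simpa using (hmem g 0).2 ⟨h.2, h.1⟩
  -- Values off `S` are never tested for positivity; zero keeps `k` symmetric everywhere.
  let ψ : G → H →L[ℂ] H := fun g => if h : g ∈ S then φ ⟨g, h⟩ else 0
  have hψφ : ∀ g (h : g ∈ S), ψ g = φ ⟨g, h⟩ := fun g h => dif_pos h
  have hψ : ∀ (n : ℕ) (g : Fin n → G), (∀ i j, -g i + g j ∈ S) →
      OperatorMatrixPosSemidef fun i j => ψ (-g i + g j) := by
    intro n g hg
    simpa only [hψφ _ (hg _ _)] using hφ n g hg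
  let k : G × H → G × H → ℝ := fun u v => (⟪u.2, ψ (-u.1 + v.1) v.2⟫_ℂ).re
  obtain ⟨B, hBsymm, hBpos, hBτ, hBk⟩ := exists_invariant_posSemidef_extension
    (fun u : G × H => π u.1) a ha k
    (fun u v => by
      have h := re_inner_symm_of_posSemidef S h0 hS ψ hψ (fun g hg => dif_neg hg) (-u.1 + v.1)
        u.2 v.2
      rwa [neg_add_rev, neg_neg] at h)
    (fun W c hW => by
      have h := hψ W.card (fun i => (W.equivFin.symm i).1.1)
        (fun i j => (hmem _ _).2 ⟨hW _ (W.equivFin.symm i).2 _ (W.equivFin.symm j).2,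
          hW _ (W.equivFin.symm j).2 _ (W.equivFin.symm i).2⟩)
        fun i => (c (W.equivFin.symm i) : ℂ) • (W.equivFin.symm i).1.2
      refine (Complex.nonneg_iff.1 h).1.trans_eq ?_
      rw [Complex.re_sum, ← Finset.sum_coe_sort W, ← Equiv.sum_comp W.equivFin.symm]
      refine Finset.sum_congr rfl fun i _ => ?_
      rw [Complex.re_sum, ← Finset.sum_coe_sort W, ← Equiv.sum_comp W.equivFin.symm]
      refine Finset.sum_congr rfl fun j _ => ?_
      simp only [map_smul, inner_smul_left, inner_smul_right, Complex.conj_ofReal,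
        Complex.re_ofReal_mul, k]
      ring)
    (fun (i : G × Circle) u => (i.1 + u.1, (i.2 : ℂ) • u.2))
    (fun i j x => Prod.ext (add_left_comm _ _ _) (smul_comm _ _ _))
    (fun i u v => by simp only [map_add, add_sub_add_left_eq_sub])
    (fun i u v _ _ => by
      simp only [k, neg_add_rev, map_smul, inner_smul_left, inner_smul_right]
      have hz : (starRingEnd ℂ) (i.2 : ℂ) * (i.2 : ℂ) = 1 := by
        rw [Complex.conj_mul', Circle.norm_coe]
        simp
      rw [add_assoc, neg_add_cancel_left, mul_left_comm, ← mul_assoc, hz, one_mul])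
  set K : G × H → G × H → ℝ := fun u v => B (.single u 1) (.single v 1) with hK
  have hKsymm : ∀ u v, K u v = K v u := fun u v => by simpa using hBsymm.eq (.single u 1) (.single v 1)
  have hdiag : ∀ x ξ η, K (x, ξ) (x, η) = (⟪ξ, ψ 0 η⟫_ℂ).re := fun x ξ η => by
    refine (hBk (x, ξ) (x, η) (by simpa using ha) (by simpa using ha)).trans ?_
    simp [k]
  have hnull : ∀ w v, B w w = 0 → B w v = 0 := fun w v h => by
    have := B.apply_sq_le_of_symm hBpos hBsymm w v
    rw [h, zero_mul] at this
    exact pow_eq_zero_iff two_ne_zero |>.1 (le_antisymm this (sq_nonneg _))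
  have hadd : ∀ x ξ η v, K (x, ξ + η) v = K (x, ξ) v + K (x, η) v := by
    intro x ξ η v
    -- The diagonal block at `x` is bilinear, so this vector has `B`-norm zero and pairs to zero
    -- with everything.
    have h := hnull (.single (x, ξ + η) 1 - .single (x, ξ) 1 - .single (x, η) 1) (.single v 1) (by
      simp only [hK] at hdiag
      simp only [map_sub, LinearMap.sub_apply, hdiag, map_add, inner_add_left, inner_add_right,
        Complex.add_re]
      ring)
    simp only [map_sub, LinearMap.sub_apply] at h
    linarith
  have hsmul : ∀ x (r : ℝ) ξ v, K (x, r • ξ) v = r * K (x, ξ) v := by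
    intro x r ξ v
    have h := hnull (.single (x, r • ξ) 1 - r • .single (x, ξ) 1) (.single v 1) (by
      simp only [hK] at hdiag
      simp only [map_sub, map_smul, LinearMap.sub_apply, LinearMap.smul_apply, hdiag,
        ← Complex.coe_smul r ξ, inner_smul_left, inner_smul_right, Complex.conj_ofReal,
        Complex.re_ofReal_mul, smul_eq_mul]
      ring)
    simp only [map_sub, map_smul, LinearMap.sub_apply, LinearMap.smul_apply, smul_eq_mul] at h
    linarith
  have hshift : ∀ h x y ξ η, K (h + x, ξ) (h + y, η) = K (x, ξ) (y, η) := fun h x y ξ η => by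
    simpa using hBτ (h, 1) (x, ξ) (y, η)
  have hKI : ∀ x y ξ η, K (x, Complex.I • ξ) (y, Complex.I • η) = K (x, ξ) (y, η) :=
    fun x y ξ η => by
      simpa using hBτ (0, ⟨Complex.I, by simp [Submonoid.unitSphere]⟩) (x, ξ) (y, η)
  have hbound : ∀ x y ξ η, |K (x, ξ) (y, η)| ≤ ‖ψ 0‖ * ‖ξ‖ * ‖η‖ := by
    intro x y ξ η
    have hd : ∀ x ζ, K (x, ζ) (x, ζ) ≤ ‖ψ 0‖ * ‖ζ‖ ^ 2 := fun x ζ => by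
      rw [hdiag]
      calc _ ≤ ‖⟪ζ, ψ 0 ζ⟫_ℂ‖ := Complex.re_le_norm _
        _ ≤ ‖ζ‖ * ‖ψ 0 ζ‖ := norm_inner_le_norm _ _
        _ ≤ ‖ζ‖ * (‖ψ 0‖ * ‖ζ‖) := by gcongr; exact (ψ 0).le_opNorm ζ
        _ = _ := by ring
    refine abs_le_of_sq_le_sq ?_ (by positivity)
    calc K (x, ξ) (y, η) ^ 2 ≤ K (x, ξ) (x, ξ) * K (y, η) (y, η) :=
          B.apply_sq_le_of_symm hBpos hBsymm _ _
      _ ≤ (‖ψ 0‖ * ‖ξ‖ ^ 2) * (‖ψ 0‖ * ‖η‖ ^ 2) :=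
          mul_le_mul (hd x ξ) (hd y η) (hBpos _) (by positivity)
      _ = _ := by ring
  choose Φ hΦ using fun g => exists_continuousLinearMap_re_inner_eq
    (fun ξ η => K (0, ξ) (g, η)) (fun _ _ _ => hadd _ _ _ _)
    (fun ξ η ζ => by simp only [hKsymm (0, ξ), hadd])
    (fun _ _ _ => hsmul _ _ _ _) (fun r ξ η => by simp only [hKsymm (0, ξ), hsmul])
    (fun _ _ => hKI _ _ _ _) ‖ψ 0‖ (fun _ _ => hbound _ _ _ _)
  have hre : ∀ x y ξ η, (⟪ξ, Φ (-x + y) η⟫_ℂ).re = K (x, ξ) (y, η) := fun x y ξ η => by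
    rw [hΦ, ← hshift x 0 (-x + y), add_zero, add_neg_cancel_left]
  refine ⟨Φ, fun n g ξ => Complex.nonneg_iff.2 ⟨?_, ?_⟩, fun x => ?_⟩
  · simp only [Complex.re_sum, hre]
    refine (hBpos (∑ i, .single (g i, ξ i) 1)).trans_eq ?_
    simp only [map_sum, LinearMap.sum_apply]
    exact Finset.sum_comm
  · have him : ∀ x y ξ η, (⟪ξ, Φ (-x + y) η⟫_ℂ).im = K (x, Complex.I • ξ) (y, η) :=
      fun x y ξ η => by rw [← hre, inner_smul_left]; simp
    -- The summands of the imaginary part are antisymmetric in the two indices, so their double sum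
    -- vanishes.
    have hanti : ∀ x y ξ η, K (x, Complex.I • ξ) (y, η) = -K (y, Complex.I • η) (x, ξ) :=
      fun x y ξ η => by
        rw [← hKI, smul_smul, Complex.I_mul_I, hKsymm (y, _), ← neg_one_mul (K _ _), ← hsmul]
        simp
    simp only [Complex.im_sum, him]
    have h : ∑ i, ∑ j, K (g i, Complex.I • ξ i) (g j, ξ j) =
        -∑ i, ∑ j, K (g i, Complex.I • ξ i) (g j, ξ j) := by
      conv_lhs => rw [Finset.sum_comm]
      simp only [← Finset.sum_neg_distrib]
      exact Finset.sum_congr rfl fun i _ => Finset.sum_congr rfl fun j _ => hanti _ _ _ _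
    linarith
  · have hx := (hmem 0 x).1 (by simp)
    have hval : ∀ ξ η, (⟪ξ, Φ x η⟫_ℂ).re = (⟪ξ, φ x η⟫_ℂ).re := fun ξ η => by
      rw [hΦ]
      refine (hBk (0, ξ) (x, η) hx.1 hx.2).trans ?_
      simp [k, hψφ _ x.2]
    ext η
    have h := inner_self_eq_norm_sq (𝕜 := ℂ) (Φ x η - φ x η)
    rw [inner_sub_right, map_sub, RCLike.re_eq_complex_re, hval, sub_self] at h
    exact sub_eq_zero.1 (norm_eq_zero.1 (pow_eq_zero_iff two_ne_zero |>.1 h.symm))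

theorem corollary3p2 {G₁ : Type*} [AddCommGroup G₁] [LinearOrder G₁] [IsOrderedAddMonoid G₁]
    {G₂ : Type*} [AddCommGroup G₂]
    {H : Type*} [NormedAddCommGroup H] [InnerProductSpace ℂ H] [CompleteSpace H]
    (a : G₁) (ha : 0 < a)
    (φ : (Set.Ioo (-a) a ×ˢ (Set.univ : Set G₂) : Set (G₁ × G₂)) → H →L[ℂ] H)
    (hφ : IsPositiveDefiniteFunOn (Set.Ioo (-a) a ×ˢ (Set.univ : Set G₂)) φ) :
    ∃ Φ : G₁ × G₂ → H →L[ℂ] H, IsPositiveDefiniteFun Φ ∧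
      ∀ x : (Set.Ioo (-a) a ×ˢ (Set.univ : Set G₂) : Set (G₁ × G₂)), Φ x = φ x := by
  exact exists_isPositiveDefiniteFun_extension (AddMonoidHom.fst G₁ G₂) a ha _
    (fun g => by simp) φ hφ
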